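/- Let $K$ be a compact Hausdorff scattered space (every nonempty subset of $K$ has a relatively isolated point) which contains a point $\infty$ such that $K\setminus\{\infty\}$ maps injectively and continuously onto a subset of $\mathbb{R}$. For a partition $\{F_1,\dots,F_k\}$ of $\{1,\dots,m\}$, a point $(x_1,\dots,x_m)\in K^m$ is called $(F_1,\dots,F_k)$-diverse if $\{x_j: j\in F_i\}\cap\{x_j: j\notin F_i\}=\emptyset$ for all $1\le i\le k$. The space $K$ is called $n$-diverse if for every $m\in\mathbb{N}$ and every partition $F_1,\dots,F_k$ of $\{1,\dots,m\}$ with $k\le n$, every sequence $(x^\alpha)_{\alpha<\omega_1}$ of $(F_1,\dots,F_k)$-diverse points of $K^m$ has a cluster point $z\in K^m$ which is $(F_1,\dots,F_k)$-diverse; here $z$ is a cluster point if every neighbourhood of $z$ contains $x^\alpha$ for infinitely many $\alpha<\omega_1$. If $K$ is $2$-diverse, then the Banach space $C(K)$ of real-valued continuous functions on $K$ (with the supremum norm) is weakly pcc; that is, every point-finite family of weakly open subsets of $C(K)$ (one in which each $f\in C(K)$ belongs to only finitely many members) is countable. -/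

import Mathlib

/-- A topological space is scattered if every nonempty subset `S` has a point that is isolated
in the subspace topology of `S`. -/
def IsScatteredSpace (X : Type*) [TopologicalSpace X] : Prop :=
  ∀ S : Set X, S.Nonempty → ∃ x ∈ S, ∃ U : Set X, IsOpen U ∧ U ∩ S = {x}

/-- A point `x = (x_1, …, x_m)` is diverse for a partition `F` of the index set if, for every part
`A` of `F`, no value of `x` on `A` is a value of `x` off `A`. -/
def IsDiversePoint {X : Type*} {m : ℕ} (F : Finpartition (Finset.univ : Finset (Fin m)))
    (x : Fin m → X) : Prop :=
  ∀ A ∈ F.parts, {y | ∃ j ∈ A, x j = y} ∩ {y | ∃ j ∉ A, x j = y} = ∅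

/-- `z` is a cluster point of the family `x` if every neighbourhood of `z` contains the terms
`x α` for infinitely many indices `α`. -/
def IsFamilyClusterPt {ι Y : Type*} [TopologicalSpace Y] (x : ι → Y) (z : Y) : Prop :=
  ∀ V ∈ nhds z, {α : ι | x α ∈ V}.Infinite

/-- A space is `n`-diverse if for every `m` and every partition `F` of an `m`-element index set
into at most `n` parts, each sequence of length `ω₁` of `F`-diverse points of the `m`-th power has
a cluster point in this power that is `F`-diverse. -/
def IsDiverseSpace (n : ℕ) (X : Type*) [TopologicalSpace X] : Prop :=
  ∀ (m : ℕ) (F : Finpartition (Finset.univ : Finset (Fin m))), F.parts.card ≤ n →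
    ∀ x : Set.Iio (Ordinal.omega.{0} 1) → (Fin m → X), (∀ α, IsDiversePoint F (x α)) →
      ∃ z : Fin m → X, IsFamilyClusterPt x z ∧ IsDiversePoint F z

/-- A real normed space is weakly pcc if each point-finite family of weakly open sets is
countable. -/
def IsWeaklyPCC (E : Type*) [NormedAddCommGroup E] [NormedSpace ℝ E] : Prop :=
  ∀ 𝒰 : Set (Set (WeakSpace ℝ E)), (∀ U ∈ 𝒰, IsOpen U) →
    (∀ f : WeakSpace ℝ E, {U ∈ 𝒰 | f ∈ U}.Finite) → 𝒰.Countable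

/-! Scatteredness makes regular measures on `K` almost finitely supported, so on bounded sets
pointwise convergence implies weak convergence (`exists_finset_forall_mem_of_isOpen`). Each nonempty
weakly open `U` thus contains all `f` of norm at most `R` with values near `s` at `p` and near `r j`
at finitely many points `x j`. If the family is uncountable, uncountably many `U` share the same
rational data, including disjoint bands for the reals `φ (x j)`. Let `z` be a cluster point of these
tuples. If some continuous `f` has `f p = s` and `f (z j) = r j`, then `f` lies in infinitely many
`U`. The bands keep different coordinates of `z` apart except at `p`, so the only obstruction is `z
j = p` with `r j ≠ s`. Diversity removes it (`exists_cluster_eq_imp_mem`): in two disjoint copies of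
the family, coordinates with `r j ≠ s` get opposite colours, so they cannot reach `p` in both
copies. -/

/-! ### Regular measures on scattered spaces -/

open MeasureTheory in
/-- A regular Borel measure on a compact scattered space charges every set of positive measure at
some point. -/
lemma exists_singleton_measure_pos_of_isScatteredSpace {K : Type*} [TopologicalSpace K]
    [T2Space K] [MeasurableSpace K] [BorelSpace K]
    (hs : IsScatteredSpace K) (ν : Measure K) [ν.Regular] [IsFiniteMeasure ν] {A : Set K}
    (hA : MeasurableSet A) (hpos : 0 < ν A) : ∃ x ∈ A, 0 < ν {x} := by
  by_contra! hcon
  have key : ∀ L : Set K, IsCompact L → 0 < ν L → ∃ y ∈ L, ∀ U, IsOpen U → y ∈ U →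
      0 < ν (U ∩ L) := by
    intro L hL hL0
    by_contra! h
    refine hL0.ne' (hL.measure_zero_of_nhdsWithin fun y hy => ?_)
    obtain ⟨U, hU, hyU, h0⟩ := h y hy
    exact ⟨U ∩ L, Filter.inter_mem (mem_nhdsWithin_of_mem_nhds (hU.mem_nhds hyU))
      self_mem_nhdsWithin, nonpos_iff_eq_zero.1 h0⟩
  obtain ⟨C, hCA, hC, hC0⟩ := hA.exists_lt_isCompact_of_ne_top (measure_ne_top ν A) hpos
  obtain ⟨y, hyC, hy⟩ := key C hC hC0
  -- Scatteredness isolates a point `x` of the support of `ν` on `C`. As `x` is null, `(U ∩ C) \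
  -- {x}` still has positive measure and so yields a second support point in `U`.
  obtain ⟨x, hx, U, hU, hUx⟩ := hs {y | y ∈ C ∧ ∀ U, IsOpen U → y ∈ U → 0 < ν (U ∩ C)}
    ⟨y, hyC, hy⟩
  have hxU : x ∈ U := (hUx.symm.subset rfl).1
  have hx0 : ν {x} = 0 := nonpos_iff_eq_zero.1 (hcon x (hCA hx.1))
  have h1 : 0 < ν ((U ∩ C) \ {x}) := by
    rw [measure_sdiff_null hx0]
    exact hx.2 U hU hxU
  have hmeas : MeasurableSet ((U ∩ C) \ {x}) :=
    (hU.measurableSet.inter hC.measurableSet).diff (measurableSet_singleton x)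
  obtain ⟨L, hLU, hL, hL0⟩ := hmeas.exists_lt_isCompact_of_ne_top (measure_ne_top ν _) h1
  obtain ⟨w, hwL, hw⟩ := key L hL hL0
  have : w ∈ ({x} : Set K) := by
    rw [← hUx]
    refine ⟨(hLU hwL).1.1, (hLU hwL).1.2, fun W hW hwW => (hw W hW hwW).trans_le ?_⟩
    exact measure_mono (Set.inter_subset_inter_right _ fun t ht => (hLU ht).1.2)
  exact (hLU hwL).2 this

open MeasureTheory in
/-- A finite regular Borel measure on a scattered space is concentrated, up to `ε`, on a finite
set. -/
lemma exists_finset_measure_compl_lt_of_isScatteredSpace {K : Type*} [TopologicalSpace K]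
    [T2Space K] [MeasurableSpace K] [BorelSpace K]
    (hs : IsScatteredSpace K) (ν : Measure K) [ν.Regular] [IsFiniteMeasure ν]
    {ε : ENNReal} (hε : 0 < ε) : ∃ F : Finset K, ν (F : Set K)ᶜ < ε := by
  classical
  set A : Set K := {x | 0 < ν {x}} with hAdef
  have hA : A.Countable := Measure.countable_meas_pos_of_disjoint_iUnion
    (fun x => measurableSet_singleton x) (fun x y h => by simpa using h)
  have hA0 : ν Aᶜ = 0 := by
    by_contra h
    obtain ⟨x, hx, hx0⟩ := exists_singleton_measure_pos_of_isScatteredSpace hs ν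
      hA.measurableSet.compl (pos_iff_ne_zero.2 h)
    exact hx hx0
  have : Countable A := hA.to_subtype
  have hd : Directed (· ⊇ ·) fun F : Finset A => ((F.image Subtype.val : Finset K) : Set K)ᶜ :=
    fun F G => ⟨F ∪ G, by simp [Finset.image_union, Set.compl_union],
      by simp [Finset.image_union, Set.compl_union]⟩
  have hInf := hd.measure_iInter (μ := ν)
    (fun F => (Finset.measurableSet _).compl.nullMeasurableSet) ⟨∅, measure_ne_top ν _⟩
  have hInter : ⋂ F : Finset A, ((F.image Subtype.val : Finset K) : Set K)ᶜ = Aᶜ := by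
    ext x
    simp only [Set.mem_iInter, Set.mem_compl_iff, Finset.coe_image, Set.mem_image,
      Finset.mem_coe]
    refine ⟨fun h hx => h {⟨x, hx⟩} ⟨⟨x, hx⟩, by simp, rfl⟩, ?_⟩
    rintro h F ⟨y, -, rfl⟩
    exact h y.2
  rw [hInter, hA0] at hInf
  obtain ⟨F, hF⟩ := iInf_lt_iff.1 (hInf ▸ hε)
  exact ⟨_, hF⟩

/-! ### Domination of functionals by measures -/

/-- The total variation of a continuous functional on `C(K, ℝ)`, evaluated at a function. -/
noncomputable def ContinuousMap.dualVariation {K : Type*} [TopologicalSpace K] [CompactSpace K]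
    (μ : C(K, ℝ) →L[ℝ] ℝ) (f : C(K, ℝ)) : ℝ :=
  sSup (μ '' {g | ∀ x, |g x| ≤ f x})

namespace ContinuousMap

variable {K : Type*} [TopologicalSpace K] [CompactSpace K] (μ : C(K, ℝ) →L[ℝ] ℝ)

lemma bddAbove_dualVariation (f : C(K, ℝ)) : BddAbove (μ '' {g | ∀ x, |g x| ≤ f x}) := by
  refine ⟨‖μ‖ * ‖f‖, ?_⟩
  rintro _ ⟨g, hg, rfl⟩
  refine (le_abs_self _).trans ((μ.le_opNorm g).trans ?_)
  refine mul_le_mul_of_nonneg_left ((ContinuousMap.norm_le _ (norm_nonneg _)).2 fun x => ?_)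
    (norm_nonneg _)
  exact (hg x).trans ((le_abs_self _).trans (f.norm_coe_le_norm x))

lemma le_dualVariation {f g : C(K, ℝ)} (h : ∀ x, |g x| ≤ f x) : μ g ≤ dualVariation μ f :=
  le_csSup (bddAbove_dualVariation μ f) ⟨g, h, rfl⟩

lemma abs_le_dualVariation {f g : C(K, ℝ)} (h : ∀ x, |g x| ≤ f x) :
    |μ g| ≤ dualVariation μ f := by
  refine abs_le'.2 ⟨le_dualVariation μ h, ?_⟩
  rw [← map_neg]
  exact le_dualVariation μ fun x => by simpa using h x

lemma dualVariation_le {f : C(K, ℝ)} (hf : ∀ x, 0 ≤ f x) {c : ℝ}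
    (h : ∀ g : C(K, ℝ), (∀ x, |g x| ≤ f x) → μ g ≤ c) : dualVariation μ f ≤ c := by
  refine csSup_le ⟨μ 0, 0, fun x => by simpa using hf x, rfl⟩ ?_
  rintro _ ⟨g, hg, rfl⟩
  exact h g hg

lemma dualVariation_nonneg {f : C(K, ℝ)} (hf : ∀ x, 0 ≤ f x) : 0 ≤ dualVariation μ f := by
  simpa using le_dualVariation μ (f := f) (g := 0) fun x => by simpa using hf x

/-- Additivity makes the variation a positive linear functional, to which the Riesz–Markov–Kakutani
theorem applies. -/
lemma dualVariation_add {f₁ f₂ : C(K, ℝ)} (h₁ : ∀ x, 0 ≤ f₁ x) (h₂ : ∀ x, 0 ≤ f₂ x) :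
    dualVariation μ (f₁ + f₂) = dualVariation μ f₁ + dualVariation μ f₂ := by
  apply le_antisymm
  · refine dualVariation_le μ (fun x => add_nonneg (h₁ x) (h₂ x)) fun g hg => ?_
    -- Riesz decomposition: clamping `g` to `[-f₁, f₁]` leaves a remainder bounded by `f₂`.
    set g₁ : C(K, ℝ) := (-f₁) ⊔ (g ⊓ f₁)
    have e : μ g = μ g₁ + μ (g - g₁) := by rw [← map_add]; congr 1; abel
    rw [e]
    refine add_le_add (le_dualVariation μ fun x => ?_) (le_dualVariation μ fun x => ?_)
    · simp only [g₁, sup_apply, inf_apply, neg_apply]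
      have := h₁ x
      grind
    · have a := h₁ x
      have b := h₂ x
      have c : |g x| ≤ f₁ x + f₂ x := hg x
      simp only [g₁, sup_apply, inf_apply, neg_apply, sub_apply]
      grind
  · rw [← le_sub_iff_add_le]
    refine dualVariation_le μ h₁ fun g hg => ?_
    rw [le_sub_iff_add_le, ← le_sub_iff_add_le']
    refine dualVariation_le μ h₂ fun k hk => ?_
    rw [le_sub_iff_add_le', ← map_add]
    exact le_dualVariation μ fun x => (abs_add_le _ _).trans (add_le_add (hg x) (hk x))

lemma dualVariation_smul_le {f : C(K, ℝ)} (hf : ∀ x, 0 ≤ f x) {c : ℝ} (hc : 0 < c) :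
    dualVariation μ (c • f) ≤ c * dualVariation μ f := by
  refine dualVariation_le μ (fun x => mul_nonneg hc.le (hf x)) fun g hg => ?_
  have e : μ g = c * μ (c⁻¹ • g) := by
    rw [map_smul, smul_eq_mul, mul_inv_cancel_left₀ hc.ne']
  rw [e]
  refine mul_le_mul_of_nonneg_left (le_dualVariation μ fun x => ?_) hc.le
  have : |g x| ≤ c * f x := hg x
  rw [smul_apply, smul_eq_mul, abs_mul, abs_of_pos (inv_pos.2 hc)]
  rwa [inv_mul_le_iff₀ hc]

lemma dualVariation_smul {f : C(K, ℝ)} (hf : ∀ x, 0 ≤ f x) {c : ℝ} (hc : 0 ≤ c) :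
    dualVariation μ (c • f) = c * dualVariation μ f := by
  rcases hc.eq_or_lt with rfl | hc
  · rw [zero_smul, zero_mul]
    refine le_antisymm (dualVariation_le μ (fun x => le_rfl) fun g hg => ?_)
      (dualVariation_nonneg μ fun x => le_rfl)
    have : g = 0 := by ext x; simpa using hg x
    simp [this]
  · refine le_antisymm (dualVariation_smul_le μ hf hc) ?_
    have h := dualVariation_smul_le μ (f := c • f) (fun x => mul_nonneg hc.le (hf x))
      (inv_pos.2 hc)
    rwa [inv_smul_smul₀ hc.ne', le_inv_mul_iff₀ hc] at h

open scoped CompactlySupported NNReal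

/-- A function with values in `ℝ≥0`, regarded as real-valued. -/
def ofNNReal (f : C_c(K, ℝ≥0)) : C(K, ℝ) := ⟨fun x => f x, by fun_prop⟩

/-- The total variation of a continuous functional, as a positive functional. -/
noncomputable def dualVariationLinearMap : C_c(K, ℝ≥0) →ₗ[ℝ≥0] ℝ≥0 where
  toFun f := ⟨dualVariation μ (ofNNReal f), dualVariation_nonneg μ fun x => (f x).2⟩
  map_add' f g := by
    apply NNReal.eq
    exact dualVariation_add μ (f₁ := ofNNReal f) (f₂ := ofNNReal g) (fun x => (f x).2)
      fun x => (g x).2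
  map_smul' c f := by
    apply NNReal.eq
    exact dualVariation_smul μ (f := ofNNReal f) (fun x => (f x).2) c.2

open MeasureTheory in
/-- A continuous functional on `C(K, ℝ)` is dominated by a finite regular measure. -/
lemma exists_measure_abs_le_integral [T2Space K] [MeasurableSpace K] [BorelSpace K] :
    ∃ ν : Measure K, ν.Regular ∧ IsFiniteMeasure ν ∧
      ∀ g : C(K, ℝ), |μ g| ≤ ∫ x, |g x| ∂ν := by
  refine ⟨NNRealRMK.rieszMeasure (dualVariationLinearMap μ), inferInstance, ?_, fun g => ?_⟩
  · have := NNRealRMK.rieszMeasure_regular (dualVariationLinearMap μ)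
    infer_instance
  · let f : C_c(K, ℝ≥0) :=
      ⟨⟨fun x => ‖g x‖₊, by fun_prop⟩, HasCompactSupport.of_compactSpace _⟩
    have h := NNRealRMK.integral_rieszMeasure (dualVariationLinearMap μ) f
    have h' : ∫ x, |g x| ∂NNRealRMK.rieszMeasure (dualVariationLinearMap μ)
      = dualVariation μ (ofNNReal f) := h
    rw [h']
    exact abs_le_dualVariation μ fun x => le_rfl

open MeasureTheory in
/-- On bounded sets, a continuous functional on `C(K, ℝ)`, for `K` compact and scattered, is
continuous at zero for the topology of pointwise convergence. -/
lemma exists_finset_abs_lt_of_isScatteredSpace [T2Space K] (hs : IsScatteredSpace K) (R : ℝ)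
    {ε : ℝ} (hε : 0 < ε) : ∃ F : Finset K, ∃ δ > 0, ∀ g : C(K, ℝ), ‖g‖ ≤ R →
      (∀ x ∈ F, |g x| < δ) → |μ g| < ε := by
  borelize K
  obtain ⟨ν, hν, hfin, hle⟩ := exists_measure_abs_le_integral μ
  have hR : 0 < |R| + 1 := by positivity
  -- Half of `ε` pays for the complement of `F`, where only the norm bound is available, and half
  -- for `F`, where `|g| < δ`.
  set a : ℝ := ε / 2 / (|R| + 1) with ha
  have ha0 : 0 < a := by positivity
  obtain ⟨F, hF⟩ := exists_finset_measure_compl_lt_of_isScatteredSpace hs ν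
    (ENNReal.ofReal_pos.2 ha0)
  have hM : 0 < ν.real Set.univ + 1 := by positivity
  refine ⟨F, ε / 2 / (ν.real Set.univ + 1), by positivity, fun g hg hgF => ?_⟩
  set δ := ε / 2 / (ν.real Set.univ + 1) with hδ
  have hδ0 : 0 < δ := by positivity
  have hint : Integrable (fun x => |g x|) ν :=
    Continuous.integrable_of_hasCompactSupport (by fun_prop) (HasCompactSupport.of_compactSpace _)
  have hFm : MeasurableSet (F : Set K) := F.measurableSet
  have hsplit := integral_add_compl hFm hint
  have h1 : ∫ x in (F : Set K), |g x| ∂ν ≤ δ * ν.real (F : Set K) := by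
    have := setIntegral_mono_on (μ := ν) (s := (F : Set K)) hint.integrableOn
      (integrable_const δ).integrableOn hFm fun x hx => (hgF x hx).le
    simpa [mul_comm] using this
  have h2 : ∫ x in (F : Set K)ᶜ, |g x| ∂ν ≤ (|R| + 1) * ν.real (F : Set K)ᶜ := by
    have := setIntegral_mono_on (μ := ν) (s := (F : Set K)ᶜ) hint.integrableOn
      (integrable_const (|R| + 1)).integrableOn hFm.compl fun x _ => by
        have := g.norm_coe_le_norm x
        rw [Real.norm_eq_abs] at this
        linarith [le_abs_self R]
    simpa [mul_comm] using this
  have h3 : ν.real (F : Set K)ᶜ < a := by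
    have := (ENNReal.toReal_lt_toReal (measure_ne_top ν _) ENNReal.ofReal_ne_top).2 hF
    rwa [ENNReal.toReal_ofReal ha0.le] at this
  have h4 : (|R| + 1) * ν.real (F : Set K)ᶜ < ε / 2 := by
    calc _ < (|R| + 1) * a := mul_lt_mul_of_pos_left h3 hR
      _ = ε / 2 := by rw [ha]; field_simp
  have h5 : δ * ν.real (F : Set K) ≤ ε / 2 := by
    calc _ ≤ δ * (ν.real Set.univ + 1) := by
          refine mul_le_mul_of_nonneg_left ?_ hδ0.le
          linarith [measureReal_mono (μ := ν) (Set.subset_univ (F : Set K))]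
      _ = ε / 2 := by rw [hδ]; field_simp
  linarith [hle g]

end ContinuousMap

/-! ### Weak versus pointwise topology -/

/-- On bounded sets, a weakly open subset of `C(K, ℝ)`, for `K` compact and scattered, is a
neighbourhood of its points for the topology of pointwise convergence. -/
lemma ContinuousMap.exists_finset_forall_mem_of_isOpen {K : Type*} [TopologicalSpace K]
    [CompactSpace K] [T2Space K] (hs : IsScatteredSpace K) {U : Set (WeakSpace ℝ C(K, ℝ))}
    (hU : IsOpen U) {f : C(K, ℝ)} (hf : toWeakSpace ℝ C(K, ℝ) f ∈ U) (R : ℝ) :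
    ∃ F : Finset K, ∃ δ > 0, ∀ g : C(K, ℝ), ‖g‖ ≤ R → (∀ x ∈ F, |g x - f x| < δ) →
      toWeakSpace ℝ C(K, ℝ) g ∈ U := by
  classical
  let N : Finset K × {δ : ℝ // 0 < δ} → Set C(K, ℝ) := fun i =>
    {g | ‖g‖ ≤ R ∧ ∀ x ∈ i.1, |g x - f x| < i.2}
  have hd : Directed (· ≥ ·) N := fun i j =>
    ⟨(i.1 ∪ j.1, ⟨min i.2 j.2, lt_min i.2.2 j.2.2⟩),
      fun g hg => ⟨hg.1, fun x hx => (hg.2 x (Finset.mem_union_left _ hx)).trans_le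
        (min_le_left _ _)⟩,
      fun g hg => ⟨hg.1, fun x hx => (hg.2 x (Finset.mem_union_right _ hx)).trans_le
        (min_le_right _ _)⟩⟩
  have : Nonempty (Finset K × {δ : ℝ // 0 < δ}) := ⟨∅, 1, one_pos⟩
  have hb := Filter.hasBasis_iInf_principal hd
  have ht : Filter.Tendsto (fun g : C(K, ℝ) => toWeakSpace ℝ C(K, ℝ) g)
      (⨅ i, Filter.principal (N i)) (nhds (toWeakSpace ℝ C(K, ℝ) f)) := by
    refine (WeakBilin.tendsto_iff_forall_eval_tendsto (topDualPairing ℝ C(K, ℝ)).flip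
      ?_).2 fun μ => ?_
    · intro a b hab
      refine (SeparatingDual.eq_iff_forall_dual_eq (R := ℝ) (V := C(K, ℝ))).2 fun μ => ?_
      exact congrArg (fun l => l μ) hab
    · refine (hb.tendsto_iff Metric.nhds_basis_ball).2 fun ε hε => ?_
      obtain ⟨F, δ, hδ, h⟩ := exists_finset_abs_lt_of_isScatteredSpace μ hs (R + ‖f‖) hε
      refine ⟨(F, ⟨δ, hδ⟩), trivial, fun g hg => ?_⟩
      have := h (g - f) ((norm_sub_le _ _).trans (by linarith [hg.1])) fun x hx => hg.2 x hx
      rw [map_sub] at this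
      exact this
  obtain ⟨i, -, hi⟩ := hb.mem_iff.1 (ht (hU.mem_nhds hf))
  exact ⟨i.1, i.2, i.2.2, fun g hg h => hi ⟨hg, h⟩⟩

/-! ### Thinning out uncountable families -/

lemma Set.exists_not_countable_fiber {α β : Type*} [Countable β] {T : Set α}
    (hT : ¬ T.Countable) {P : α → β → Prop} (h : ∀ a ∈ T, ∃ b, P a b) :
    ∃ b, ¬ {a ∈ T | P a b}.Countable := by
  by_contra! hcon
  refine hT ((Set.countable_iUnion hcon).mono fun a ha => ?_)
  obtain ⟨b, hb⟩ := h a ha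
  exact Set.mem_iUnion.2 ⟨b, ha, hb⟩

/-- If every fibre is countable, the image is uncountable and a transversal of the fibres is
injective. -/
lemma Set.exists_subset_not_countable_const_or_injOn {α β : Type*} {T : Set α}
    (hT : ¬ T.Countable) (g : α → β) :
    ∃ S ⊆ T, ¬ S.Countable ∧ ((∃ b, ∀ a ∈ S, g a = b) ∨ Set.InjOn g S) := by
  by_cases h : ∃ b, ¬ {a ∈ T | g a = b}.Countable
  · obtain ⟨b, hb⟩ := h
    exact ⟨_, fun a ha => ha.1, hb, Or.inl ⟨b, fun a ha => ha.2⟩⟩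
  · push Not at h
    obtain ⟨S, hST, hS⟩ := (Set.surjOn_image g T).exists_bijOn_subset
    refine ⟨S, hST, fun hc => hT ?_, Or.inr hS.injOn⟩
    have hi : (g '' T).Countable := by rw [← hS.image_eq]; exact hc.image g
    refine (hi.biUnion fun b _ => h b).mono fun a ha => ?_
    exact Set.mem_biUnion (Set.mem_image_of_mem g ha) ⟨ha, rfl⟩

lemma Set.exists_subset_not_countable_forall_const_or_injOn {ι α β : Type*} [Finite ι]
    {T : Set α} (hT : ¬ T.Countable) (g : ι → α → β) :
    ∃ S ⊆ T, ¬ S.Countable ∧ ∀ i, (∃ b, ∀ a ∈ S, g i a = b) ∨ Set.InjOn (g i) S := by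
  classical
  have := Fintype.ofFinite ι
  suffices ∀ J : Finset ι, ∃ S ⊆ T, ¬ S.Countable ∧
      ∀ i ∈ J, (∃ b, ∀ a ∈ S, g i a = b) ∨ Set.InjOn (g i) S by
    simpa using this Finset.univ
  intro J
  induction J using Finset.induction_on with
  | empty => exact ⟨T, subset_rfl, hT, by simp⟩
  | insert i J _ ih =>
    obtain ⟨S, hST, hS, h⟩ := ih
    obtain ⟨S', hS'S, hS', h'⟩ := Set.exists_subset_not_countable_const_or_injOn hS (g i)
    refine ⟨S', hS'S.trans hST, hS', fun j hj => ?_⟩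
    rcases Finset.mem_insert.1 hj with rfl | hj
    · exact h'
    · rcases h j hj with ⟨b, hb⟩ | hinj
      · exact Or.inl ⟨b, fun a ha => hb a (hS'S ha)⟩
      · exact Or.inr (hinj.mono hS'S)

open Cardinal in
/-- An uncountable set contains two disjoint copies of `ω₁`. -/
lemma Set.exists_embedding_bool_prod_omega_one {α : Type*} {T : Set α} (hT : ¬ T.Countable) :
    Nonempty (Bool × Set.Iio (Ordinal.omega.{0} 1) ↪ T) := by
  rw [← Cardinal.lift_mk_le']
  have h1 : ℵ₁ ≤ #T := by
    rw [aleph_one_le_iff, ← not_le, mk_le_aleph0_iff, Set.countable_coe_iff]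
    exact hT
  have h2 : #(Bool × Set.Iio (Ordinal.omega.{0} 1)) = ℵ₁ := by
    rw [mk_prod, mk_Iio_ordinal, Ordinal.card_omega]
    simp only [mk_fintype, Fintype.card_bool, lift_aleph, lift_natCast,
      Ordinal.lift_one]
    exact Cardinal.mul_eq_right (aleph0_le_aleph 1)
      (natCast_lt_aleph0.le.trans (aleph0_le_aleph 1)) (by simp)
  rw [h2, lift_aleph, Ordinal.lift_one]
  simpa using h1

/-! ### Cluster points from diversity -/

/-- Diversity of a space for partitions into at most two parts, in terms of colourings of an
arbitrary finite index set with two colours. -/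
lemma IsDiverseSpace.exists_cluster_of_coloring {X : Type*} [TopologicalSpace X]
    (h : IsDiverseSpace 2 X) {ι : Type*} [Finite ι] (c : ι → Bool)
    (x : Set.Iio (Ordinal.omega.{0} 1) → ι → X)
    (hx : ∀ α i j, c i ≠ c j → x α i ≠ x α j) :
    ∃ z : ι → X, IsFamilyClusterPt x z ∧ ∀ i j, c i ≠ c j → z i ≠ z j := by
  classical
  have := Fintype.ofFinite ι
  obtain ⟨m, ⟨e⟩⟩ := Finite.exists_equiv_fin ι
  let F : Finpartition (Finset.univ : Finset (Fin m)) :=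
    Finpartition.ofSetoid (Setoid.ker fun j => c (e.symm j))
  have hmem : ∀ A ∈ F.parts, ∀ i ∈ A, ∀ j, j ∈ A ↔ c (e.symm i) = c (e.symm j) := by
    intro A hA i hi j
    rw [← F.part_eq_of_mem hA hi]
    exact Finpartition.mem_part_ofSetoid_iff_rel
  have hcard : F.parts.card ≤ 2 := by
    choose a ha using fun A : F.parts => F.nonempty_of_mem_parts A.2
    rw [← Fintype.card_coe, ← Fintype.card_bool]
    refine Fintype.card_le_of_injective (fun A => c (e.symm (a A))) fun A B hAB => Subtype.ext ?_
    exact F.eq_of_mem_parts A.2 B.2 ((hmem A A.2 _ (ha A) _).2 hAB) (ha B)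
  obtain ⟨z, hz, hdiv⟩ := h m F hcard (fun α j => x α (e.symm j)) fun α A hA => by
    rw [Set.eq_empty_iff_forall_notMem]
    rintro y ⟨⟨i, hi, hiy⟩, j, hj, hjy⟩
    exact hx α (e.symm i) (e.symm j) (fun hc => hj ((hmem A hA i hi j).2 hc))
      (hiy.trans hjy.symm)
  refine ⟨fun i => z (e i), fun V hV => ?_, fun i j hij hzij => ?_⟩
  · have hcont : Continuous fun (w : Fin m → X) (i : ι) => w (e i) := by fun_prop
    have := hz _ (hcont.continuousAt.preimage_mem_nhds hV)
    simpa using this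
  · obtain ⟨A, hA, hiA⟩ := F.exists_mem (Finset.mem_univ (e i))
    have hj : e j ∉ A := fun hj => hij (by simpa using (hmem A hA _ hiA _).1 hj)
    exact Set.eq_empty_iff_forall_notMem.1 (hdiv A hA) (z (e i))
      ⟨⟨e i, hiA, rfl⟩, ⟨e j, hj, hzij.symm⟩⟩

lemma IsFamilyClusterPt.mem_of_isClosed {κ ι X : Type*} [TopologicalSpace X]
    {x : κ → ι → X} {z : ι → X} (hz : IsFamilyClusterPt x z) {i : ι} {C : Set X}
    (hC : IsClosed C) (h : ∀ α, x α i ∈ C) : z i ∈ C := by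
  by_contra hcon
  have hopen : IsOpen {w : ι → X | w i ∈ Cᶜ} := hC.isOpen_compl.preimage (continuous_apply i)
  have := hz _ (hopen.mem_nhds hcon)
  exact this (by simp [h])

/-- A finite set of prescribed values is attained by a continuous function with the same bound. -/
lemma ContinuousMap.exists_forall_eq_of_finite {K ι : Type*} [TopologicalSpace K]
    [CompactSpace K] [T2Space K] [Finite ι] (z : ι → K) (r : ι → ℝ)
    (hr : ∀ i j, z i = z j → r i = r j) {R : ℝ} (hR : 0 ≤ R) (hrR : ∀ i, |r i| ≤ R) :
    ∃ f : C(K, ℝ), ‖f‖ ≤ R ∧ ∀ i, f (z i) = r i := by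
  have hfin : (Set.range z).Finite := Set.finite_range z
  have := hfin.to_subtype
  let g : C(Set.range z, ℝ) := ⟨fun y => r y.2.choose, continuous_of_discreteTopology⟩
  obtain ⟨f, hf, hfg⟩ := g.exists_restrict_eq_forall_mem_of_closed (t := Set.Icc (-R) R)
    (fun y => abs_le.1 (hrR _)) ⟨0, by simpa⟩ hfin.isClosed
  refine ⟨f, (ContinuousMap.norm_le _ hR).2 fun x => abs_le.2 (hf x), fun i => ?_⟩
  have h1 := DFunLike.congr_fun hfg ⟨z i, i, rfl⟩
  have h2 : z (Set.mem_range_self (f := z) i).choose = z i :=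
    (Set.mem_range_self (f := z) i).choose_spec
  exact h1.trans (hr _ _ h2)

/-- Two families of points indexed by `ω₁`, with values in an uncountable family, whose pointwise
values are separated outside `p`, have a cluster point of at least one of them at which `p` is
approached only along the coordinates in `J`. -/
lemma IsDiverseSpace.exists_cluster_eq_imp_mem {K : Type*} [TopologicalSpace K] [T2Space K]
    (hdiverse : IsDiverseSpace 2 K) (p : K) {α : Type*} {T : Set α} (hT : ¬ T.Countable)
    {m : ℕ} (x : α → Fin m → K) (hxp : ∀ a ∈ T, ∀ j, x a j ≠ p) (J : Set (Fin m))
    (hsep : ∀ a ∈ T, ∀ b ∈ T, ∀ i j, i ≠ j → x a i ≠ x b j) :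
    ∃ (u : Set.Iio (Ordinal.omega.{0} 1) ↪ α) (z : Fin m → K), (∀ s, u s ∈ T) ∧
      IsFamilyClusterPt (fun s => x (u s)) z ∧ ∀ j, z j = p → j ∈ J := by
  classical
  obtain ⟨S, hST, hS, hconst⟩ :=
    Set.exists_subset_not_countable_forall_const_or_injOn hT fun j a => x a j
  obtain ⟨u⟩ := Set.exists_embedding_bool_prod_omega_one hS
  -- The colours of an injective coordinate are swapped between the copies. A constant coordinate
  -- agrees in both copies, so it must keep a single colour.
  let c : Bool × Fin m → Bool := fun i =>
    if Set.InjOn (fun a => x a i.2) S then xor i.1 (decide (i.2 ∈ J)) else true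
  obtain ⟨z, hz, hzc⟩ := hdiverse.exists_cluster_of_coloring c
    (fun s i => x (u (i.1, s)) i.2) (by
      rintro s ⟨b, i⟩ ⟨b', j⟩ hc
      by_cases hij : i = j
      · subst hij
        by_cases hi : Set.InjOn (fun a => x a i) S
        · intro he
          have := hi (u (b, s)).2 (u (b', s)).2 he
          have := u.injective (Subtype.ext this)
          simp only [Prod.mk.injEq, and_true] at this
          exact hc (by rw [this])
        · simp [c, hi] at hc
      · exact hsep _ (hST (u _).2) _ (hST (u _).2) i j hij)
  -- A constant coordinate stays at its value, which is not `p`.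
  have hinj : ∀ b j, z (b, j) = p → Set.InjOn (fun a => x a j) S := by
    intro b j hp
    refine (hconst j).resolve_left ?_
    rintro ⟨y, hy⟩
    have h1 : z (b, j) ∈ ({y} : Set K) :=
      hz.mem_of_isClosed isClosed_singleton fun s => hy _ (u (b, s)).2
    have hne : S.Nonempty := Set.nonempty_iff_ne_empty.2 fun h => hS (h ▸ Set.countable_empty)
    obtain ⟨a, ha⟩ := hne
    exact hxp a (hST ha) j ((hy a ha).trans (h1.symm.trans hp))
  -- If both copies failed, coordinates outside `J` with opposite colours would meet at `p`.
  have hgood : ∃ b, ∀ j, z (b, j) = p → j ∈ J := by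
    by_contra! h
    obtain ⟨i, hi, hiJ⟩ := h false
    obtain ⟨j, hj, hjJ⟩ := h true
    refine hzc (false, i) (true, j) ?_ (hi.trans hj.symm)
    simp [c, hinj _ _ hi, hinj _ _ hj, hiJ, hjJ]
  obtain ⟨b, hb⟩ := hgood
  refine ⟨⟨fun s => u (b, s), fun s t hst => ?_⟩, fun j => z (b, j), fun s => hST (u _).2,
    fun V hV => ?_, hb⟩
  · have := u.injective (Subtype.ext hst)
    simpa using this
  · have hcont : Continuous fun (w : Bool × Fin m → K) (j : Fin m) => w (b, j) := by fun_prop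
    exact hz _ (hcont.continuousAt.preimage_mem_nhds hV)

/-! ### Rational data and the main argument -/

/-- A finite family of distinct reals is approximated by rationals, with disjoint error
intervals. -/
lemma exists_rat_approx_of_injective {m : ℕ} {t : Fin m → ℝ} (ht : Function.Injective t) :
    ∃ (η : ℚ) (q : Fin m → ℚ), (∀ i, |t i - q i| < η) ∧
      ∀ i j, i ≠ j → (2 * η : ℝ) < |(q i : ℝ) - q j| := by
  obtain ⟨ε, hε, hεt⟩ : ∃ ε > 0, ∀ i j, i ≠ j → ε ≤ |t i - t j| := by
    have hfin := Set.finite_range fun ij : {ij : Fin m × Fin m // ij.1 ≠ ij.2} =>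
      |t ij.1.1 - t ij.1.2|
    rcases isEmpty_or_nonempty {ij : Fin m × Fin m // ij.1 ≠ ij.2} with h | h
    · exact ⟨1, one_pos, fun i j hij => (h.false ⟨(i, j), hij⟩).elim⟩
    · obtain ⟨ij, hij⟩ := Finite.exists_min
        fun ij : {ij : Fin m × Fin m // ij.1 ≠ ij.2} => |t ij.1.1 - t ij.1.2|
      exact ⟨_, abs_pos.2 (sub_ne_zero.2 (ht.ne ij.2)), fun i j h => hij ⟨(i, j), h⟩⟩
  -- Centres within `η` of reals `ε` apart differ by more than `ε - 2η > 2η`.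
  obtain ⟨η, hη0, hη⟩ := exists_rat_btwn (show (0 : ℝ) < ε / 4 by positivity)
  choose q hq1 hq2 using fun i => exists_rat_btwn (show t i < t i + η by linarith)
  refine ⟨η, q, fun i => ?_, fun i j hij => ?_⟩
  · rw [abs_lt]
    constructor <;> linarith [hq1 i, hq2 i]
  · have := hεt i j hij
    have := hq1 i
    have := hq2 i
    have := hq1 j
    have := hq2 j
    grind

lemma exists_rat_abs_le_and_abs_sub_lt {y R ε : ℝ} (hy : |y| ≤ R) (hε : 0 < ε) :
    ∃ r : ℚ, |(r : ℝ)| ≤ R + ε ∧ |r - y| < ε := by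
  obtain ⟨r, h1, h2⟩ := exists_rat_btwn (show y < y + ε by linarith)
  exact ⟨r, by grind, by grind⟩

theorem mainTheorem11 {K : Type*} [TopologicalSpace K] [CompactSpace K] [T2Space K]
    (hscattered : IsScatteredSpace K)
    (hmap : ∃ p : K, ∃ φ : {x : K // x ≠ p} → ℝ, Continuous φ ∧ Function.Injective φ)
    (hdiverse : IsDiverseSpace 2 K) :
    IsWeaklyPCC C(K, ℝ) := by
  classical
  obtain ⟨p, φ, hφ, hφi⟩ := hmap
  intro 𝒰 hopen hfinite
  by_contra hunc
  have hunc' : ¬ (𝒰 \ {∅}).Countable := fun h =>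
    hunc ((h.union (Set.countable_singleton ∅)).mono (by simp))
  -- The data `d` range over a countable type; only the points `x` are left existential.
  let P (U : Set (WeakSpace ℝ C(K, ℝ)))
      (d : Σ m : ℕ, ℕ × ℚ × ℚ × ℚ × (Fin m → ℚ) × (Fin m → ℚ)) : Prop :=
    let ⟨m, R, δ, η, s, q, r⟩ := d
    0 < δ ∧ (∀ i j, i ≠ j → (2 * η : ℝ) < |(q i : ℝ) - q j|) ∧ |(s : ℝ)| ≤ R ∧
      (∀ j, |(r j : ℝ)| ≤ R) ∧ ∃ x : Fin m → {x : K // x ≠ p},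
        (∀ j, |φ (x j) - q j| < η) ∧ ∀ f : C(K, ℝ), ‖f‖ ≤ R → |f p - s| < δ →
          (∀ j, |f (x j) - r j| < δ) → toWeakSpace ℝ C(K, ℝ) f ∈ U
  have hP : ∀ U ∈ 𝒰 \ {∅}, ∃ d, P U d := by
    rintro U ⟨hU, hne⟩
    obtain ⟨f₀, hf₀⟩ := Set.nonempty_iff_ne_empty.2 hne
    obtain ⟨f₀, rfl⟩ := (toWeakSpace ℝ C(K, ℝ)).surjective f₀
    -- The slack `1` absorbs the rounding error `δ < 1`, so the rational target values remain
    -- bounded by `R`.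
    obtain ⟨R, hR⟩ := exists_nat_ge (‖f₀‖ + 1)
    obtain ⟨F, ε, hε, hF⟩ :=
      ContinuousMap.exists_finset_forall_mem_of_isOpen hscattered (hopen U hU) hf₀ R
    obtain ⟨δ, hδ0, hδ⟩ := exists_rat_btwn (show (0 : ℝ) < min (ε / 2) 1 by positivity)
    have hδε : (δ : ℝ) < ε / 2 := hδ.trans_le (min_le_left _ _)
    have hδ1 : (δ : ℝ) < 1 := hδ.trans_le (min_le_right _ _)
    let G : Finset {x : K // x ≠ p} := F.subtype fun x => x ≠ p
    let x : Fin G.card → {x : K // x ≠ p} := fun j => G.equivFin.symm j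
    have hx : Function.Injective x := Subtype.val_injective.comp G.equivFin.symm.injective
    obtain ⟨η, q, hq, hsep⟩ := exists_rat_approx_of_injective (hφi.comp hx)
    have hr : ∀ y : K, ∃ r : ℚ, |(r : ℝ)| ≤ R ∧ |r - f₀ y| < δ := fun y => by
      obtain ⟨r, h1, h2⟩ := exists_rat_abs_le_and_abs_sub_lt (f₀.norm_coe_le_norm y) hδ0
      exact ⟨r, by linarith, h2⟩
    choose r hrR hr using hr
    refine ⟨⟨G.card, R, δ, η, r p, q, fun j => r (x j)⟩, by exact_mod_cast hδ0, hsep, hrR p,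
      fun j => hrR _, x, hq, fun f hf hfp hfx => hF f hf fun y hy => ?_⟩
    have hfy : |f y - r y| < δ := by
      by_cases hyp : y = p
      · rwa [hyp]
      · have hyG : (⟨y, hyp⟩ : {x : K // x ≠ p}) ∈ G := Finset.mem_subtype.2 hy
        have := hfx (G.equivFin ⟨_, hyG⟩)
        simpa [x] using this
    have h2 := hr y
    have h3 := abs_sub_le (f y) (r y) (f₀ y)
    linarith
  obtain ⟨⟨m, R, δ, η, s, q, r⟩, hT⟩ := Set.exists_not_countable_fiber hunc' hP
  set T := {U ∈ 𝒰 \ {∅} | P U ⟨m, R, δ, η, s, q, r⟩} with hTdef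
  obtain ⟨U₀, hU₀⟩ : T.Nonempty :=
    Set.nonempty_iff_ne_empty.2 fun h => hT (h ▸ Set.countable_empty)
  obtain ⟨hδ, hsep, hs, hr, -⟩ := hU₀.2
  have hx : ∀ U, ∃ x : Fin m → K, U ∈ T → (∀ j, ∃ h : x j ≠ p, |φ ⟨x j, h⟩ - q j| < η) ∧
      ∀ f : C(K, ℝ), ‖f‖ ≤ R → |f p - s| < δ → (∀ j, |f (x j) - r j| < δ) →
        toWeakSpace ℝ C(K, ℝ) f ∈ U := by
    intro U
    by_cases hU : U ∈ T
    · obtain ⟨-, -, -, -, x, h1, h2⟩ := hU.2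
      exact ⟨fun j => x j, fun _ => ⟨fun j => ⟨(x j).2, h1 j⟩, h2⟩⟩
    · exact ⟨fun _ => p, fun h => (hU h).elim⟩
  choose x hx using hx
  have hband : ∀ {i j : Fin m} {y : {x : K // x ≠ p}}, i ≠ j → |φ y - q i| ≤ η →
      |φ y - q j| ≤ η → False := by
    intro i j y hij hi hj
    have := hsep i j hij
    have := abs_sub_le (q i : ℝ) (φ y) (q j)
    rw [abs_sub_comm] at hi
    linarith
  obtain ⟨u, z, huT, hz, hzp⟩ := hdiverse.exists_cluster_eq_imp_mem p hT x
    (fun U hU j => ((hx U hU).1 j).1) {j | r j = s} fun U hU V hV i j hij he => by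
      obtain ⟨h1, h2⟩ := (hx U hU).1 i
      obtain ⟨h3, h4⟩ := (hx V hV).1 j
      simp only [he] at h2
      exact hband hij h2.le h4.le
  -- Since `φ` is continuous only off `p`, the closed set used is the closed band together with `p`.
  have hzq : ∀ j, ∀ h : z j ≠ p, |φ ⟨z j, h⟩ - q j| ≤ η := by
    intro j h
    have hC : IsClosed (Subtype.val '' {y : {x : K // x ≠ p} | η < |φ y - q j|})ᶜ := by
      rw [isClosed_compl_iff]
      refine (isOpen_ne.isOpenEmbedding_subtypeVal).isOpenMap _ ?_
      exact isOpen_lt continuous_const (by fun_prop)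
    have := hz.mem_of_isClosed (i := j) hC fun a => by
      rintro ⟨y, hy, hyx⟩
      obtain ⟨h1, h2⟩ := (hx _ (huT a)).1 j
      simp only [← hyx] at h2
      exact lt_asymm hy h2
    by_contra! hcon
    exact this ⟨⟨z j, h⟩, hcon, rfl⟩
  have hzr : ∀ i j, z i = z j → r i = r j := by
    intro i j hij
    by_cases hi : z i = p
    · exact (hzp i hi).trans (hzp j (hij ▸ hi)).symm
    · by_contra hne
      have h1 := hzq i hi
      have h2 := hzq j (hij ▸ hi)
      simp only [hij] at h1
      exact hband (fun h => hne (by rw [h])) h1 h2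
  -- The index `none` stands for `p` with value `s`; `hzp` and `hzr` make the prescription
  -- consistent.
  obtain ⟨f, hfR, hf⟩ := ContinuousMap.exists_forall_eq_of_finite
    (fun o : Option (Fin m) => o.elim p z) (fun o => o.elim (s : ℝ) fun j => r j)
    (by
      rintro (_ | i) (_ | j) h
      · rfl
      · exact congrArg (Rat.cast (K := ℝ)) (hzp j h.symm).symm
      · exact congrArg (Rat.cast (K := ℝ)) (hzp i h)
      · exact congrArg (Rat.cast (K := ℝ)) (hzr i j h))
    (R := R) (Nat.cast_nonneg R) (by rintro (_ | j); exacts [hs, hr j])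
  have hV : {w : Fin m → K | ∀ j, |f (w j) - r j| < δ} ∈ nhds z := by
    refine IsOpen.mem_nhds ?_ fun j => ?_
    · simp only [Set.ofPred_forall]
      exact isOpen_iInter_of_finite fun j => isOpen_lt (by fun_prop) continuous_const
    · have : f (z j) = r j := hf (some j)
      rw [this, sub_self, abs_zero]
      exact_mod_cast hδ
  -- Infinitely many indices give infinitely many distinct members containing `f`, as `u` is
  -- injective.
  refine ((hz _ hV).image u.injective.injOn).mono ?_ (hfinite (toWeakSpace ℝ C(K, ℝ) f))
  rintro _ ⟨a, ha, rfl⟩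
  refine ⟨(huT a).1.1, (hx _ (huT a)).2 f hfR ?_ ha⟩
  have : f p = s := hf none
  rw [this, sub_self, abs_zero]
  exact_mod_cast hδ
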